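/- Let $S=\prod_{p\ \mathrm{prime}}p^{\varepsilon_p}$, $\varepsilon_p\in\{0,1,\dots,\infty\}$, be an infinite supernatural number, i.e. $\sum_p\varepsilon_p=\infty$. Let $\mathbb Z/S\mathbb Z=\prod_p\mathbb Z/p^{\varepsilon_p}\mathbb Z$ (with $\mathbb Z/p^{\infty}\mathbb Z=\mathbb Z_p$, the $p$-adic integers) carry the product topology, and let $\varphi(x)=x+1$ on $\mathbb Z/S\mathbb Z$. On $\ell^2(\mathbb Z_{\ge 0})$ with canonical basis $(E^+_k)_{k\ge0}$ let $U$ be the unilateral shift, $UE^+_k=E^+_{k+1}$, and for $f\in C(\mathbb Z/S\mathbb Z)$ (complex-valued continuous functions) let $M_fE^+_k=f(k)E^+_k$. The Bunce-Deddens-Toeplitz algebra $A_S=C^*\{U,M_f: f\in C(\mathbb Z/S\mathbb Z)\}$ is the C*-algebra of operators on $\ell^2(\mathbb Z_{\ge0})$ generated by $U$ and all $M_f$. Consider pairs $(u,\iota)$ in a unital C*-algebra $B$, where $u\in B$ is an isometry ($u^*u=1$) and $\iota:C(\mathbb Z/S\mathbb Z)\to B$ is a unital $*$-homomorphism (one writes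 $f$ for $\iota(f)$), such that for all $f\in C(\mathbb Z/S\mathbb Z)$ $$fu=u\,(f\circ\varphi)\quad\text{and}\quad fp_0=f(0)p_0,\qquad\text{where } p_0=[u^*,u]=u^*u-uu^*.$$ A unital C*-algebra $A$ with such a pair $(u,\iota)$ is called universal if it is generated as a C*-algebra by $u$ and $\iota(C(\mathbb Z/S\mathbb Z))$ and if for every such pair $(v,\kappa)$ in a unital C*-algebra $B$ there is a unique unital $*$-homomorphism $\pi:A\to B$ with $\pi(u)=v$ and $\pi\circ\iota=\kappa$. Then the universal C*-algebra $A$ with these generators and relations is isomorphic with $A_S$. Precisely: $A_S$ with $(U,\,f\mapsto M_f)$ is universal, and for every universal $(A,u,\iota)$ there is a unique $*$-isomorphism $\Phi:A\to A_S$ with $\Phi(u)=U$ and $\Phi(\iota(f))=M_f$ for all $f\in C(\mathbb Z/S\mathbb Z)$. -/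

import Mathlib

open scoped ENNReal

universe v w

noncomputable section

namespace BunceDeddensToeplitz

/-- A supernatural number `∏ p ^ ε_p`, given by its exponents `ε_p ∈ {0, 1, …, ∞}`. -/
abbrev Supernatural : Type := Nat.Primes → ℕ∞

/-- `S` is infinite when `∑ ε_p = ∞`. -/
def Supernatural.IsInfinite (S : Supernatural) : Prop :=
  ∑' p : Nat.Primes, ((S p : ℕ∞) : ℝ≥0∞) = ∞

instance factPrime (p : Nat.Primes) : Fact (p : ℕ).Prime := ⟨p.2⟩

/-- `ℤ / p ^ e ℤ` for `e ∈ {0, 1, …, ∞}`; for `e = ∞` this is the ring of `p`-adic integers. -/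
def LocalFactor (p : Nat.Primes) : ℕ∞ → Type
  | ⊤ => ℤ_[(p : ℕ)]
  | (n : ℕ) => ZMod ((p : ℕ) ^ n)

instance (p : Nat.Primes) : (e : ℕ∞) → CommRing (LocalFactor p e)
  | ⊤ => inferInstanceAs (CommRing ℤ_[(p : ℕ)])
  | (n : ℕ) => inferInstanceAs (CommRing (ZMod ((p : ℕ) ^ n)))

/-- The `p`-adic topology for `e = ∞`, the discrete topology otherwise. -/
instance (p : Nat.Primes) : (e : ℕ∞) → TopologicalSpace (LocalFactor p e)
  | ⊤ => inferInstanceAs (TopologicalSpace ℤ_[(p : ℕ)])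
  | (_ : ℕ) => ⊥

instance (p : Nat.Primes) : (e : ℕ∞) → IsTopologicalRing (LocalFactor p e)
  | ⊤ => inferInstanceAs (IsTopologicalRing ℤ_[(p : ℕ)])
  | (n : ℕ) =>
    haveI : DiscreteTopology (LocalFactor p (n : ℕ)) := ⟨rfl⟩
    inferInstance

instance (p : Nat.Primes) : (e : ℕ∞) → CompactSpace (LocalFactor p e)
  | ⊤ => inferInstanceAs (CompactSpace ℤ_[(p : ℕ)])
  | (n : ℕ) =>
    haveI : Finite (LocalFactor p (n : ℕ)) :=
      inferInstanceAs (Finite (ZMod ((p : ℕ) ^ n)))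
    inferInstance

/-- The `S`-adic ring `ℤ / S ℤ = ∏ p, ℤ / p ^ ε_p ℤ` with the product topology. -/
abbrev SAdic (S : Supernatural) : Type := ∀ p : Nat.Primes, LocalFactor p (S p)

variable (S : Supernatural)

/-- The odometer `φ x = x + 1`. -/
def odometer : C(SAdic S, SAdic S) := ⟨fun x => x + 1, by fun_prop⟩

/-- The Hilbert space `ℓ²(ℤ_{≥ 0})`. -/
abbrev HPlus : Type := lp (fun _ : ℕ => ℂ) 2

/-- The canonical basis vectors `E⁺_k`. -/
def basisVec (k : ℕ) : HPlus := lp.single 2 k 1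

theorem summable_sq (x : HPlus) : Summable fun k => ‖x k‖ ^ 2 := by
  simpa using (lp.memℓp x).summable (by norm_num)

theorem norm_sq_eq (x : HPlus) : ‖x‖ ^ 2 = ∑' k, ‖x k‖ ^ 2 := by
  simpa using lp.norm_rpow_eq_tsum (p := 2) (by norm_num) x

theorem memlp_of_summable_sq {x : ℕ → ℂ} (h : Summable fun k => ‖x k‖ ^ 2) :
    Memℓp x 2 := by
  apply memℓp_gen
  simpa using h

/-- The sequence `(0, x 0, x 1, …)`. -/
def shiftSeq (x : ℕ → ℂ) : ℕ → ℂ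
  | 0 => 0
  | k + 1 => x k

/-- The unilateral shift `U E⁺_k = E⁺_{k+1}`. -/
def shift : HPlus →L[ℂ] HPlus :=
  LinearIsometry.toContinuousLinearMap
    { toFun := fun x => ⟨shiftSeq x, memlp_of_summable_sq
        ((summable_nat_add_iff 1).1 (by simpa [shiftSeq] using summable_sq x))⟩
      map_add' := fun x y => by
        ext k
        change shiftSeq (x + y : HPlus) k = shiftSeq x k + shiftSeq y k
        cases k <;> simp [shiftSeq]
      map_smul' := fun c x => by
        ext k; cases k <;> simp [shiftSeq]
      norm_map' := fun x => by
        refine (sq_eq_sq₀ (norm_nonneg _) (norm_nonneg _)).1 ?_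
        rw [norm_sq_eq, norm_sq_eq]
        change ∑' k, ‖shiftSeq x k‖ ^ 2 = _
        rw [Summable.tsum_eq_zero_add
          ((summable_nat_add_iff 1).1 (by simpa [shiftSeq] using summable_sq x))]
        simp [shiftSeq] }

theorem shift_basisVec (k : ℕ) : shift (basisVec k) = basisVec (k + 1) := by
  ext j
  change shiftSeq (basisVec k) j = basisVec (k + 1) j
  cases j <;> simp [shiftSeq, basisVec, Pi.single_apply]

variable {S}

/-- The diagonal operator `M_f E⁺_k = f(k) E⁺_k`. -/
def diagOp (f : C(SAdic S, ℂ)) : HPlus →L[ℂ] HPlus :=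
  LinearMap.mkContinuous
    { toFun := fun x => ⟨fun k => f (k : SAdic S) * x k, memlp_of_summable_sq
        (Summable.of_nonneg_of_le (fun _ => by positivity)
          (fun k => by
            rw [norm_mul, mul_pow]
            gcongr
            exact f.norm_coe_le_norm _)
          ((summable_sq x).mul_left (‖f‖ ^ 2)))⟩
      map_add' := fun x y => by
        ext k
        exact mul_add _ _ _
      map_smul' := fun c x => by ext k; simp [mul_left_comm] }
    ‖f‖ (fun x => by
      refine (sq_le_sq₀ (norm_nonneg _) (by positivity)).1 ?_
      rw [norm_sq_eq, mul_pow, norm_sq_eq, ← tsum_mul_left]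
      have h : ∀ k : ℕ, ‖f (k : SAdic S) * x k‖ ^ 2 ≤ ‖f‖ ^ 2 * ‖x k‖ ^ 2 := fun k => by
        rw [norm_mul, mul_pow]
        gcongr
        exact f.norm_coe_le_norm _
      exact Summable.tsum_le_tsum h
        (Summable.of_nonneg_of_le (fun _ => by positivity) h
          ((summable_sq x).mul_left (‖f‖ ^ 2)))
        ((summable_sq x).mul_left (‖f‖ ^ 2)))

theorem diagOp_apply (f : C(SAdic S, ℂ)) (x : HPlus) (k : ℕ) :
    diagOp f x k = f (k : SAdic S) * x k := rfl

theorem diagOp_basisVec (f : C(SAdic S, ℂ)) (k : ℕ) :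
    diagOp f (basisVec k) = f (k : SAdic S) • basisVec k := by
  ext j
  rw [diagOp_apply]
  by_cases h : j = k
  · subst h; simp [basisVec]
  · simp [basisVec, h]

variable (S)

/-- `f ↦ M_f` as a unital `*`-homomorphism `C(ℤ/Sℤ) → B(ℓ²(ℤ_{≥ 0}))`. -/
def diagHom : C(SAdic S, ℂ) →⋆ₐ[ℂ] (HPlus →L[ℂ] HPlus) where
  toFun := diagOp
  map_one' := by ext x k; simp [diagOp_apply]
  map_mul' f g := by ext x k; simp [diagOp_apply, mul_assoc]
  map_zero' := by ext x k; simp [diagOp_apply]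
  map_add' f g := by ext x k; simp [diagOp_apply, add_mul]
  commutes' c := by
    ext x k
    simp [diagOp_apply, Algebra.algebraMap_eq_smul_one]
  map_star' f := by
    rw [ContinuousLinearMap.star_eq_adjoint, ContinuousLinearMap.eq_adjoint_iff]
    intro x y
    rw [lp.inner_eq_tsum, lp.inner_eq_tsum]
    refine tsum_congr fun k => ?_
    simp [diagOp_apply]
    ring

/-- The Bunce-Deddens-Toeplitz algebra `A_S = C*{U, M_f : f ∈ C(ℤ/Sℤ)}`: the norm closure in
`B(ℓ²(ℤ_{≥ 0}))` of the `*`-algebra generated by `U` and all `M_f`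
(it contains the identity `U* U = M_1`). -/
def toeplitzAlgebra : StarSubalgebra ℂ (HPlus →L[ℂ] HPlus) :=
  (StarAlgebra.adjoin ℂ ({shift} ∪ Set.range (diagHom S))).topologicalClosure

instance : CStarAlgebra (toeplitzAlgebra S) :=
  StarSubalgebra.cstarAlgebra _ (h_closed := StarSubalgebra.isClosed_topologicalClosure _)

/-- `U` as an element of `A_S`. -/
def shiftElem : toeplitzAlgebra S :=
  ⟨shift, StarSubalgebra.le_topologicalClosure _
    (StarAlgebra.subset_adjoin ℂ _ (Or.inl rfl))⟩

/-- `f ↦ M_f` as a unital `*`-homomorphism `C(ℤ/Sℤ) → A_S`. -/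
def diagElem : C(SAdic S, ℂ) →⋆ₐ[ℂ] toeplitzAlgebra S :=
  (diagHom S).codRestrict _ fun f => StarSubalgebra.le_topologicalClosure _
    (StarAlgebra.subset_adjoin ℂ _ (Or.inr ⟨f, rfl⟩))

/-- A representation of the generators and relations in a unital C*-algebra `B`: an isometry `u`
and a unital copy of `C(ℤ/Sℤ)` (possibly not faithful) with `f u = u (f ∘ φ)` and
`f p₀ = f(0) p₀`, where `p₀ = [u*, u]`. -/
structure SatisfiesRelations {B : Type*} [CStarAlgebra B] (u : B)
    (ι : C(SAdic S, ℂ) →⋆ₐ[ℂ] B) : Prop where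
  isometry : star u * u = 1
  comm : ∀ f : C(SAdic S, ℂ), ι f * u = u * ι (f.comp (odometer S))
  proj : ∀ f : C(SAdic S, ℂ),
    ι f * (star u * u - u * star u) = f 0 • (star u * u - u * star u)

/-- `(A, u, ι)` is the universal C*-algebra for these generators and relations: the relations
hold, `A` is generated as a C*-algebra by `u` and the image of `ι`, and every representation
`(v, κ)` of the generators and relations in a unital C*-algebra `B` (of universe `w`) is induced
by a unique unital `*`-homomorphism `A → B`. -/
structure IsUniversal (A : Type v) [CStarAlgebra A] (u : A)
    (ι : C(SAdic S, ℂ) →⋆ₐ[ℂ] A) : Prop where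
  relations : SatisfiesRelations S u ι
  generates : (StarAlgebra.adjoin ℂ ({u} ∪ Set.range ι)).topologicalClosure = ⊤
  existsUnique_lift : ∀ (B : Type w) [CStarAlgebra B] (v : B) (κ : C(SAdic S, ℂ) →⋆ₐ[ℂ] B),
    SatisfiesRelations S v κ → ∃! π : A →⋆ₐ[ℂ] B, π u = v ∧ ∀ f, π (ι f) = κ f

end BunceDeddensToeplitz

end

noncomputable section

namespace BunceDeddensToeplitz
/-! ### Density of the natural numbers in the `S`-adic ring -/

/-! Every representation `(u, ι)` must be shown to be dominated in norm by the concrete one on `ℓ²`.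
To compare them, both are placed side by side in the product `B(ℓ²) × B`, where the pair of
generators again satisfies the relations.

The relations reduce every *-polynomial to a sum of monomials `u ^ m * ι f * (u*) ^ n`. If all
exponents are at most `d`, repeated use of `f = f(0) p₀ + u (f ∘ φ) u*` rewrites the sum as a
combination of matrix units `u ^ i * p₀ * (u*) ^ j` with `i, j < 2d`, plus `2d + 1` diagonals that
start at position `d`. On `ℓ²` the coefficients can be recovered from the operator: beyond column
`2d` only the diagonals survive, and their entries are values of the coefficient functions at
natural numbers, which are dense in `ℤ/Sℤ` even after finitely many are discarded. Subtracting the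
diagonals leaves the finite matrix. Hence `‖x.2‖ ≤ 16 (d + 1) ^ 3 ‖x.1‖` in degree `d`
(`SatisfiesRelations.norm_canonical_le`).

Degree grows only linearly under powers. Applying the estimate to `(x* x) ^ (2 ^ n)` and using the
C*-identity, the polynomial factor is beaten by exponential growth, so `‖x.2‖ ≤ ‖x.1‖`
(`SatisfiesRelations.norm_snd_le_of_mem_adjoin`). The closed algebra generated by the joint
generators is therefore the graph of a homomorphism from `A_S` to `B`. This gives universality, and
the isomorphism follows from it. -/

theorem LocalFactor.exists_modEq_mem (p : Nat.Primes) (e : ℕ∞) (x : LocalFactor p e)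
    {V : Set (LocalFactor p e)} (hV : IsOpen V) (hx : x ∈ V) :
    ∃ k a : ℕ, ∀ n : ℕ, n ≡ a [MOD (p : ℕ) ^ k] → (n : LocalFactor p e) ∈ V := by
  match e, x, V, hV, hx with
  | ⊤, x, V, hV, hx =>
    change ℤ_[(p : ℕ)] at x
    change Set ℤ_[(p : ℕ)] at V
    obtain ⟨ε, hε, hball⟩ := Metric.isOpen_iff.1 hV x hx
    obtain ⟨k, hk⟩ := PadicInt.exists_pow_neg_lt (p : ℕ) hε
    refine ⟨k, x.appr k, fun n hn => hball ?_⟩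
    change dist (n : ℤ_[(p : ℕ)]) x < ε
    rw [dist_comm, dist_eq_norm]
    refine lt_of_le_of_lt ?_ hk
    rw [PadicInt.norm_le_pow_iff_mem_span_pow]
    have h1 := PadicInt.appr_spec k x
    have h2 : (x.appr k : ℤ_[(p : ℕ)]) - n ∈ Ideal.span {((p : ℕ) : ℤ_[(p : ℕ)]) ^ k} := by
      obtain ⟨c, hc⟩ := (Nat.modEq_iff_dvd.1 hn)
      refine Ideal.mem_span_singleton.2 ⟨(c : ℤ_[(p : ℕ)]), ?_⟩
      exact_mod_cast congrArg (Int.cast : ℤ → ℤ_[(p : ℕ)]) hc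
    simpa using Ideal.add_mem _ h1 h2
  | (m : ℕ), x, V, hV, hx =>
    change ZMod ((p : ℕ) ^ m) at x
    refine ⟨m, x.val, fun n hn => ?_⟩
    have : (n : ZMod ((p : ℕ) ^ m)) = x := by
      rw [(ZMod.natCast_eq_natCast_iff _ _ _).2 hn]
      exact ZMod.natCast_zmod_val x
    have h : (n : LocalFactor p m) = x := this
    rwa [h]

/-- A basic open set restricts finitely many coordinates, each by a congruence modulo a power of its
prime. The moduli are coprime, so the Chinese remainder theorem supplies a natural number. -/
theorem denseRange_natCast (S : Supernatural) : DenseRange (Nat.cast : ℕ → SAdic S) := by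
  classical
  rw [DenseRange, dense_iff_inter_open]
  rintro V hV ⟨x, hx⟩
  obtain ⟨I, t, ht, hsub⟩ := isOpen_pi_iff.1 hV x hx
  choose! k a ha using fun p (hp : p ∈ I) =>
    LocalFactor.exists_modEq_mem p (S p) (x p) (ht p hp).1 (ht p hp).2
  have hco : Set.Pairwise (I : Set Nat.Primes)
      (Function.onFun Nat.Coprime fun p => (p : ℕ) ^ k p) := fun p _ q _ hpq =>
    Nat.Coprime.pow _ _ ((Nat.coprime_primes p.2 q.2).2 fun h => hpq (Subtype.ext h))
  obtain ⟨n, hn⟩ := Nat.chineseRemainderOfFinset a (fun p => (p : ℕ) ^ k p) I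
    (fun p _ => pow_ne_zero _ p.2.ne_zero) hco
  exact ⟨n, hsub fun p hp => ha p hp n (hn p hp), n, rfl⟩

/-- Translation by `N` is a homeomorphism. This allows matrix entries near the corner to be ignored
when a function is recovered from a diagonal. -/
theorem denseRange_natCast_add (S : Supernatural) (N : ℕ) :
    DenseRange (fun n : ℕ => ((n + N : ℕ) : SAdic S)) := by
  have h : DenseRange ((fun x : SAdic S => x + (N : SAdic S)) ∘ (Nat.cast : ℕ → SAdic S)) :=
    (Homeomorph.addRight (N : SAdic S)).surjective.denseRange.comp (denseRange_natCast S)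
      (by fun_prop)
  simpa [Function.comp_def] using h

theorem norm_le_of_forall_natCast {S : Supernatural} (f : C(SAdic S, ℂ)) (N : ℕ) {r : ℝ}
    (h : ∀ n : ℕ, ‖f ((n + N : ℕ) : SAdic S)‖ ≤ r) : ‖f‖ ≤ r := by
  have h0 : 0 ≤ r := (norm_nonneg _).trans (h 0)
  refine (ContinuousMap.norm_le f h0).2 fun x => ?_
  refine (denseRange_natCast_add S N).induction_on (p := fun x => ‖f x‖ ≤ r) x ?_ h
  exact isClosed_le (by fun_prop) (by fun_prop)

/-! ### The relations in the concrete representation -/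

theorem shift_apply_zero (x : HPlus) : shift x 0 = 0 := rfl

theorem shift_apply_succ (x : HPlus) (k : ℕ) : shift x (k + 1) = x k := rfl

theorem basisVec_apply (j i : ℕ) : basisVec j i = if i = j then 1 else 0 := by
  simp [basisVec, Pi.single_apply]

theorem norm_basisVec (j : ℕ) : ‖basisVec j‖ = 1 := by
  simp [basisVec, lp.norm_single (p := 2) (by norm_num)]

theorem norm_entry_le (T : HPlus →L[ℂ] HPlus) (i j : ℕ) : ‖T (basisVec j) i‖ ≤ ‖T‖ := by
  refine (lp.norm_apply_le_norm (by norm_num) _ i).trans ?_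
  simpa [norm_basisVec] using T.le_opNorm (basisVec j)

theorem star_shift_mul_shift : star shift * shift = 1 := by
  obtain ⟨L, hL⟩ : ∃ L : HPlus →ₗᵢ[ℂ] HPlus, shift = L.toContinuousLinearMap := ⟨_, rfl⟩
  rw [ContinuousLinearMap.star_eq_adjoint, hL]
  exact (ContinuousLinearMap.norm_map_iff_adjoint_comp_self _).1 L.norm_map

theorem star_shift_apply (x : HPlus) (k : ℕ) : star shift x k = x (k + 1) := by
  have h1 : inner ℂ (basisVec k) (star shift x) = inner ℂ (shift (basisVec k)) x := by
    rw [ContinuousLinearMap.star_eq_adjoint, ContinuousLinearMap.adjoint_inner_right]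
  rw [shift_basisVec] at h1
  have h2 : ∀ (j : ℕ) (y : HPlus), inner ℂ (basisVec j) y = y j := fun j y => by
    simp [basisVec, lp.inner_single_left]
  rwa [h2, h2] at h1

theorem star_shift_basisVec_succ (k : ℕ) : star shift (basisVec (k + 1)) = basisVec k := by
  ext i; simp [star_shift_apply, basisVec_apply]

theorem star_shift_basisVec_zero : star shift (basisVec 0) = 0 := by
  ext i; simp [star_shift_apply, basisVec_apply]

theorem shift_pow_basisVec (m k : ℕ) : (shift ^ m) (basisVec k) = basisVec (k + m) := by
  induction m with
  | zero => simp
  | succ m ih => rw [pow_succ', mul_apply_eq_comp, ih, shift_basisVec]; rfl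

theorem star_shift_pow_basisVec_add (m k : ℕ) :
    (star shift ^ m) (basisVec (k + m)) = basisVec k := by
  induction m with
  | zero => simp
  | succ m ih =>
    rw [pow_succ, mul_apply_eq_comp, ← add_assoc, star_shift_basisVec_succ, ih]

theorem star_shift_pow_basisVec_of_le {m k : ℕ} (h : m ≤ k) :
    (star shift ^ m) (basisVec k) = basisVec (k - m) := by
  simpa [Nat.sub_add_cancel h] using star_shift_pow_basisVec_add m (k - m)

theorem star_shift_pow_basisVec_of_lt {m k : ℕ} (h : k < m) :
    (star shift ^ m) (basisVec k) = 0 := by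
  obtain ⟨r, rfl⟩ := Nat.exists_eq_add_of_lt h
  have h1 := star_shift_pow_basisVec_add k 0
  rw [zero_add] at h1
  rw [show k + r + 1 = r + 1 + k by ring, pow_add, pow_succ, mul_apply_eq_comp, h1,
    mul_apply_eq_comp, star_shift_basisVec_zero, map_zero]

theorem rangeProj_shift_apply (x : HPlus) (k : ℕ) :
    (star shift * shift - shift * star shift) x k = if k = 0 then x 0 else 0 := by
  rw [star_shift_mul_shift]
  cases k with
  | zero => simp [shift_apply_zero]
  | succ k => simp [shift_apply_succ, star_shift_apply]

theorem satisfiesRelations_shift (S : Supernatural) :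
    SatisfiesRelations S shift (diagHom S) where
  isometry := star_shift_mul_shift
  comm f := by
    ext x k
    change f (k : SAdic S) * shift x k = shift (diagOp (f.comp (odometer S)) x) k
    cases k with
    | zero => simp [shift_apply_zero]
    | succ k => simp [shift_apply_succ, diagOp_apply, odometer]
  proj f := by
    ext x k
    change f (k : SAdic S) * ((star shift * shift - shift * star shift) x) k
      = f 0 * ((star shift * shift - shift * star shift) x) k
    rw [rangeProj_shift_apply]
    by_cases h : k = 0 <;> simp [h]

end BunceDeddensToeplitz

namespace BunceDeddensToeplitz
open Finset

/-! ### Consequences of the relations -/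

variable {S : Supernatural}

/-- The translate `x ↦ f (x + n)`, that is, `f ∘ φ ^ n`. -/
def translate (n : ℕ) (f : C(SAdic S, ℂ)) : C(SAdic S, ℂ) :=
  f.comp ⟨fun x => x + (n : SAdic S), by fun_prop⟩

theorem translate_apply (n : ℕ) (f : C(SAdic S, ℂ)) (x : SAdic S) :
    translate n f x = f (x + (n : SAdic S)) := rfl

theorem translate_zero (f : C(SAdic S, ℂ)) : translate 0 f = f := by
  ext x; simp [translate_apply]

theorem translate_succ (n : ℕ) (f : C(SAdic S, ℂ)) :
    translate (n + 1) f = (translate n f).comp (odometer S) := by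
  ext x
  simp [translate_apply, odometer, add_assoc, add_comm (1 : SAdic S)]

namespace SatisfiesRelations

variable {B : Type*} [CStarAlgebra B] {u : B} {ι : C(SAdic S, ℂ) →⋆ₐ[ℂ] B}

/-- This is the adjoint of the commutation relation for `star f`. -/
theorem star_mul_map (h : SatisfiesRelations S u ι) (f : C(SAdic S, ℂ)) :
    star u * ι f = ι (f.comp (odometer S)) * star u := by
  have h1 := congrArg star (h.comm (star f))
  rw [star_mul, star_mul, ← map_star, ← map_star, star_star] at h1
  rw [h1]
  congr 2
  ext x; simp

theorem map_mul_pow (h : SatisfiesRelations S u ι) (f : C(SAdic S, ℂ)) (n : ℕ) :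
    ι f * u ^ n = u ^ n * ι (translate n f) := by
  induction n with
  | zero => simp [translate_zero]
  | succ n ih => rw [pow_succ, ← mul_assoc, ih, mul_assoc, h.comm, translate_succ, mul_assoc]

theorem star_pow_mul_map (h : SatisfiesRelations S u ι) (f : C(SAdic S, ℂ)) (n : ℕ) :
    star u ^ n * ι f = ι (translate n f) * star u ^ n := by
  induction n with
  | zero => simp [translate_zero]
  | succ n ih =>
    rw [pow_succ', mul_assoc, ih, ← mul_assoc, h.star_mul_map, translate_succ, mul_assoc]

theorem star_pow_mul_pow (h : SatisfiesRelations S u ι) (n : ℕ) : star u ^ n * u ^ n = 1 := by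
  induction n with
  | zero => simp
  | succ n ih =>
    rw [pow_succ, pow_succ', mul_assoc, ← mul_assoc (star u) u, h.isometry, one_mul, ih]

theorem star_pow_mul_pow_add (h : SatisfiesRelations S u ι) (n k : ℕ) :
    star u ^ n * u ^ (n + k) = u ^ k := by
  rw [pow_add, ← mul_assoc, h.star_pow_mul_pow, one_mul]

theorem star_pow_add_mul_pow (h : SatisfiesRelations S u ι) (n k : ℕ) :
    star u ^ (n + k) * u ^ n = star u ^ k := by
  rw [add_comm, pow_add, mul_assoc, h.star_pow_mul_pow, mul_one]

/-- Multiply `1 = p₀ + u u*` on the left by `ι f` and apply the two relations to the summands. -/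
theorem map_eq_add (h : SatisfiesRelations S u ι) (f : C(SAdic S, ℂ)) :
    ι f = f 0 • (star u * u - u * star u) + u * ι (f.comp (odometer S)) * star u := by
  rw [← h.proj f, ← h.comm f, mul_sub, h.isometry]
  noncomm_ring

/-- Iterating `map_eq_add` inside the monomial peels off one matrix unit at a time. The free
parameter `r` serves to bring monomials on the same diagonal to a common starting position. -/
theorem monomial_eq_sum_add (h : SatisfiesRelations S u ι) (f : C(SAdic S, ℂ)) (m n r : ℕ) :
    u ^ m * ι f * star u ^ n =
      ∑ i ∈ range r, f (i : SAdic S) •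
        (u ^ (m + i) * (star u * u - u * star u) * star u ^ (n + i)) +
      u ^ (m + r) * ι (translate r f) * star u ^ (n + r) := by
  induction r with
  | zero => simp [translate_zero]
  | succ r ih =>
    have hr : translate r f 0 = f (r : SAdic S) := by simp [translate_apply]
    rw [ih, h.map_eq_add (translate r f), hr, sum_range_succ, translate_succ, add_assoc]
    congr 1
    rw [mul_add, add_mul, mul_smul_comm, smul_mul_assoc, ← add_assoc m, ← add_assoc n, pow_succ u,
      pow_succ' (star u) (n + r)]
    simp only [mul_assoc]

end SatisfiesRelations

/-! ### Filtration by degree and canonical forms -/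

section Filtration

variable {B : Type*} [CStarAlgebra B]

/-- The span of the monomials `u ^ m * ι f * (u*) ^ n` with `m, n ≤ d`. -/
def monomialSpan (u : B) (ι : C(SAdic S, ℂ) →⋆ₐ[ℂ] B) (d : ℕ) : Submodule ℂ B :=
  Submodule.span ℂ {x | ∃ m n : ℕ, m ≤ d ∧ n ≤ d ∧ ∃ f, x = u ^ m * ι f * star u ^ n}

variable {u : B} {ι : C(SAdic S, ℂ) →⋆ₐ[ℂ] B}

theorem monomial_mem_monomialSpan {d m n : ℕ} (hm : m ≤ d) (hn : n ≤ d) (f : C(SAdic S, ℂ)) :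
    u ^ m * ι f * star u ^ n ∈ monomialSpan u ι d :=
  Submodule.subset_span ⟨m, n, hm, hn, f, rfl⟩

theorem monomialSpan_mono {d e : ℕ} (h : d ≤ e) : monomialSpan u ι d ≤ monomialSpan u ι e :=
  Submodule.span_mono fun _ ⟨m, n, hm, hn, hf⟩ => ⟨m, n, hm.trans h, hn.trans h, hf⟩

theorem star_mem_monomialSpan {d : ℕ} {x : B} (hx : x ∈ monomialSpan u ι d) :
    star x ∈ monomialSpan u ι d := by
  induction hx using Submodule.span_induction with
  | mem x hx =>
    obtain ⟨m, n, hm, hn, f, rfl⟩ := hx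
    rw [star_mul, star_mul, star_pow, star_star, ← map_star, ← mul_assoc, star_pow]
    exact monomial_mem_monomialSpan hn hm _
  | zero => simp
  | add x y _ _ hx hy => rw [star_add]; exact add_mem hx hy
  | smul c x _ hx => rw [star_smul]; exact Submodule.smul_mem _ _ hx

/-- In a product of monomials the inner factor `(u*) ^ n * u ^ p` cancels to a power of `u` or of
`u*`, which then moves past the adjacent function at the cost of a translation. -/
theorem SatisfiesRelations.mul_mem_monomialSpan (h : SatisfiesRelations S u ι) {d e : ℕ}
    {x y : B} (hx : x ∈ monomialSpan u ι d) (hy : y ∈ monomialSpan u ι e) :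
    x * y ∈ monomialSpan u ι (d + e) := by
  have key := Submodule.mul_mem_mul hx hy
  refine (?_ : monomialSpan u ι d * monomialSpan u ι e ≤ monomialSpan u ι (d + e)) key
  rw [monomialSpan, monomialSpan, Submodule.span_mul_span, Submodule.span_le]
  rintro _ ⟨_, ⟨m, n, hm, hn, f, rfl⟩, _, ⟨p, q, hp, hq, g, rfl⟩, rfl⟩
  change u ^ m * ι f * star u ^ n * (u ^ p * ι g * star u ^ q) ∈ monomialSpan u ι (d + e)
  rcases le_total n p with hnp | hpn
  · obtain ⟨k, rfl⟩ := Nat.exists_eq_add_of_le hnp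
    have : u ^ m * ι f * star u ^ n * (u ^ (n + k) * ι g * star u ^ q) =
        u ^ (m + k) * ι (translate k f * g) * star u ^ q := by
      calc _ = u ^ m * ι f * (star u ^ n * u ^ (n + k)) * ι g * star u ^ q := by
            simp only [mul_assoc]
        _ = u ^ m * (ι f * u ^ k) * ι g * star u ^ q := by
            rw [h.star_pow_mul_pow_add]; simp only [mul_assoc]
        _ = _ := by rw [h.map_mul_pow, map_mul, pow_add]; simp only [mul_assoc]
    rw [this]
    exact monomial_mem_monomialSpan (by omega) (by omega) _
  · obtain ⟨k, rfl⟩ := Nat.exists_eq_add_of_le hpn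
    have : u ^ m * ι f * star u ^ (p + k) * (u ^ p * ι g * star u ^ q) =
        u ^ m * ι (f * translate k g) * star u ^ (k + q) := by
      calc _ = u ^ m * ι f * (star u ^ (p + k) * u ^ p) * ι g * star u ^ q := by
            simp only [mul_assoc]
        _ = u ^ m * ι f * (star u ^ k * ι g) * star u ^ q := by
            rw [h.star_pow_add_mul_pow]; simp only [mul_assoc]
        _ = _ := by rw [h.star_pow_mul_map, map_mul, pow_add]; simp only [mul_assoc]
    rw [this]
    exact monomial_mem_monomialSpan (by omega) (by omega) _

theorem map_mem_monomialSpan (f : C(SAdic S, ℂ)) (d : ℕ) : ι f ∈ monomialSpan u ι d := by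
  simpa using monomial_mem_monomialSpan (u := u) (ι := ι) (Nat.zero_le d) (Nat.zero_le d) f

theorem SatisfiesRelations.pow_mem_monomialSpan (h : SatisfiesRelations S u ι) {d : ℕ} {x : B}
    (hx : x ∈ monomialSpan u ι d) (n : ℕ) : x ^ n ∈ monomialSpan u ι (n * d) := by
  induction n with
  | zero => simpa using map_mem_monomialSpan (u := u) (ι := ι) 1 0
  | succ n ih =>
    rw [pow_succ, Nat.succ_mul]
    exact h.mul_mem_monomialSpan ih hx

theorem SatisfiesRelations.exists_mem_monomialSpan (h : SatisfiesRelations S u ι) {x : B}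
    (hx : x ∈ StarAlgebra.adjoin ℂ ({u} ∪ Set.range ι)) : ∃ d, x ∈ monomialSpan u ι d := by
  induction hx using StarAlgebra.adjoin_induction with
  | mem x hx =>
    rcases hx with rfl | ⟨f, rfl⟩
    · exact ⟨1, by simpa using monomial_mem_monomialSpan (u := x) (ι := ι) le_rfl zero_le_one 1⟩
    · exact ⟨0, map_mem_monomialSpan f 0⟩
  | algebraMap c => exact ⟨0, by rw [← AlgHomClass.commutes ι c]; exact map_mem_monomialSpan _ 0⟩
  | add x y _ _ hx hy =>
    obtain ⟨d, hd⟩ := hx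
    obtain ⟨e, he⟩ := hy
    exact ⟨max d e, add_mem (monomialSpan_mono (le_max_left _ _) hd)
      (monomialSpan_mono (le_max_right _ _) he)⟩
  | mul x y _ _ hx hy =>
    obtain ⟨d, hd⟩ := hx
    obtain ⟨e, he⟩ := hy
    exact ⟨d + e, h.mul_mem_monomialSpan hd he⟩
  | star x _ hx =>
    obtain ⟨d, hd⟩ := hx
    exact ⟨d, star_mem_monomialSpan hd⟩

/-- A linear combination of the matrix units `u ^ i * p₀ * (u*) ^ j`, `i, j < 2 * d`. -/
def matrixPart (u : B) (d : ℕ) (c : ℕ → ℕ → ℂ) : B :=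
  ∑ i ∈ range (2 * d), ∑ j ∈ range (2 * d),
    c i j • (u ^ i * (star u * u - u * star u) * star u ^ j)

/-- A combination of banded monomials of bandwidth at most `d`, all starting at position `d`. -/
def bandPart (u : B) (ι : C(SAdic S, ℂ) →⋆ₐ[ℂ] B) (d : ℕ) (a b : ℕ → C(SAdic S, ℂ)) : B :=
  ∑ k ∈ range (d + 1), u ^ (d + k) * ι (a k) * star u ^ d +
    ∑ k ∈ range d, u ^ d * ι (b k) * star u ^ (d + k + 1)

/-- The elements that are the sum of a matrix part and a band part. -/
def canonicalSubmodule (u : B) (ι : C(SAdic S, ℂ) →⋆ₐ[ℂ] B) (d : ℕ) : Submodule ℂ B where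
  carrier := {x | ∃ c a b, x = matrixPart u d c + bandPart u ι d a b}
  zero_mem' := ⟨0, 0, 0, by simp [matrixPart, bandPart]⟩
  add_mem' := by
    rintro _ _ ⟨c, a, b, rfl⟩ ⟨c', a', b', rfl⟩
    refine ⟨c + c', a + a', b + b', ?_⟩
    simp only [matrixPart, bandPart, Pi.add_apply, add_smul, map_add, mul_add, add_mul,
      sum_add_distrib]
    abel
  smul_mem' := by
    rintro r _ ⟨c, a, b, rfl⟩
    refine ⟨r • c, r • a, r • b, ?_⟩
    simp only [matrixPart, bandPart, Pi.smul_apply, smul_eq_mul, mul_smul, map_smul,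
      mul_smul_comm, smul_mul_assoc, smul_add, smul_sum]

theorem matrixUnit_mem_canonicalSubmodule {d i j : ℕ} (hi : i < 2 * d) (hj : j < 2 * d) :
    u ^ i * (star u * u - u * star u) * star u ^ j ∈ canonicalSubmodule u ι d := by
  refine ⟨Pi.single i (Pi.single j 1), 0, 0, ?_⟩
  rw [matrixPart, sum_eq_single i, sum_eq_single j]
  · simp [bandPart]
  · intro b _ hb; simp [hb]
  · intro h'; exact absurd (mem_range.2 hj) h'
  · intro b _ hb; simp [hb]
  · intro h'; exact absurd (mem_range.2 hi) h'

theorem lowerBand_mem_canonicalSubmodule {d k : ℕ} (hk : k < d + 1) (f : C(SAdic S, ℂ)) :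
    u ^ (d + k) * ι f * star u ^ d ∈ canonicalSubmodule u ι d := by
  refine ⟨0, Pi.single k f, 0, ?_⟩
  rw [bandPart, sum_eq_single k]
  · simp [matrixPart]
  · intro b _ hb; simp [hb]
  · intro h'; exact absurd (mem_range.2 hk) h'

theorem upperBand_mem_canonicalSubmodule {d k : ℕ} (hk : k < d) (f : C(SAdic S, ℂ)) :
    u ^ d * ι f * star u ^ (d + k + 1) ∈ canonicalSubmodule u ι d := by
  refine ⟨0, 0, Pi.single k f, ?_⟩
  rw [bandPart, sum_eq_single k (s := range d)]
  · simp [matrixPart]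
  · intro b _ hb; simp [hb]
  · intro h'; exact absurd (mem_range.2 hk) h'

theorem SatisfiesRelations.monomialSpan_le_canonicalSubmodule (h : SatisfiesRelations S u ι)
    (d : ℕ) : monomialSpan u ι d ≤ canonicalSubmodule u ι d := by
  refine Submodule.span_le.2 ?_
  rintro _ ⟨m, n, hm, hn, f, rfl⟩
  change _ ∈ canonicalSubmodule u ι d
  -- This number of steps raises the smaller exponent to exactly `d`. Each matrix unit peeled off
  -- has indices below `d + d`.
  rw [h.monomial_eq_sum_add f m n (d - min m n)]
  refine add_mem (sum_mem fun i hi => Submodule.smul_mem _ _ ?_) ?_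
  · have := mem_range.1 hi
    exact matrixUnit_mem_canonicalSubmodule (by omega) (by omega)
  · rcases le_or_gt n m with hnm | hmn
    · rw [show m + (d - min m n) = d + (m - n) by omega, show n + (d - min m n) = d by omega]
      exact lowerBand_mem_canonicalSubmodule (by omega) _
    · rw [show m + (d - min m n) = d by omega,
        show n + (d - min m n) = d + (n - m - 1) + 1 by omega]
      exact upperBand_mem_canonicalSubmodule (by omega) _

end Filtration

end BunceDeddensToeplitz

namespace BunceDeddensToeplitz
open Finset

variable {S : Supernatural}

/-! ### Matrix entries of canonical forms on `ℓ²(ℤ_{≥ 0})` -/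

theorem rangeProj_shift_basisVec (k : ℕ) :
    (star shift * shift - shift * star shift) (basisVec k) = if k = 0 then basisVec 0 else 0 := by
  ext i
  rw [rangeProj_shift_apply]
  by_cases hk : k = 0
  · subst hk; by_cases hi : i = 0 <;> simp [basisVec_apply, hi]
  · simp [basisVec_apply, hk, Ne.symm hk]

theorem matrixUnit_shift_basisVec (i j k : ℕ) :
    (shift ^ i * (star shift * shift - shift * star shift) * star shift ^ j) (basisVec k) =
      if k = j then basisVec i else 0 := by
  rw [mul_apply_eq_comp, mul_apply_eq_comp]
  rcases lt_trichotomy k j with h | h | h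
  · rw [star_shift_pow_basisVec_of_lt h]; simp [h.ne]
  · subst h
    rw [star_shift_pow_basisVec_of_le le_rfl, rangeProj_shift_basisVec, if_pos (Nat.sub_self k), if_pos rfl,
      shift_pow_basisVec, zero_add]
  · rw [star_shift_pow_basisVec_of_le h.le, rangeProj_shift_basisVec]
    simp [h.ne', Nat.sub_eq_zero_iff_le, h.not_ge]

theorem monomial_shift_basisVec (f : C(SAdic S, ℂ)) (m : ℕ) {n k : ℕ} (h : n ≤ k) :
    (shift ^ m * diagHom S f * star shift ^ n) (basisVec k) =
      f ((k - n : ℕ) : SAdic S) • basisVec (k - n + m) := by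
  rw [mul_apply_eq_comp, mul_apply_eq_comp, star_shift_pow_basisVec_of_le h]
  change (shift ^ m) (diagOp f (basisVec (k - n))) = _
  rw [diagOp_basisVec, map_smul, shift_pow_basisVec]

theorem matrixPart_shift_basisVec (d : ℕ) (c : ℕ → ℕ → ℂ) (k : ℕ) :
    matrixPart shift d c (basisVec k) =
      ∑ i ∈ range (2 * d), ∑ j ∈ range (2 * d),
        c i j • (if k = j then basisVec i else 0) := by
  simp only [matrixPart, _root_.sum_apply, smul_apply,
    matrixUnit_shift_basisVec]

theorem lp_sum_apply {α : Type*} (s : Finset α) (x : α → HPlus) (i : ℕ) :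
    (∑ k ∈ s, x k) i = ∑ k ∈ s, x k i := by
  rw [lp.coeFn_sum, Finset.sum_apply]

theorem matrixPart_shift_entry {d i j : ℕ} (c : ℕ → ℕ → ℂ) (hi : i < 2 * d) (hj : j < 2 * d) :
    matrixPart shift d c (basisVec j) i = c i j := by
  rw [matrixPart_shift_basisVec, lp_sum_apply, sum_eq_single i]
  · rw [lp_sum_apply, sum_eq_single j]
    · simp [basisVec_apply]
    · intro b _ hb; simp [hb.symm]
    · intro h; exact absurd (mem_range.2 hj) h
  · intro b _ hb
    rw [lp_sum_apply]
    refine sum_eq_zero fun k _ => ?_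
    split_ifs <;> simp [basisVec_apply, hb.symm]
  · intro h; exact absurd (mem_range.2 hi) h

theorem matrixPart_shift_basisVec_of_le {d k : ℕ} (c : ℕ → ℕ → ℂ) (hk : 2 * d ≤ k) :
    matrixPart shift d c (basisVec k) = 0 := by
  rw [matrixPart_shift_basisVec]
  refine sum_eq_zero fun i _ => sum_eq_zero fun j hj => ?_
  have := mem_range.1 hj
  rw [if_neg (by omega), smul_zero]

/-- All powers of `u*` in the band part are at most `2 * d`, so none annihilates a basis vector with
`k ≥ 2 * d`, and each monomial contributes to a single diagonal. -/
theorem bandPart_shift_entry {d k i : ℕ} (a b : ℕ → C(SAdic S, ℂ)) (hk : 2 * d ≤ k) :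
    bandPart shift (diagHom S) d a b (basisVec k) i =
      ∑ l ∈ range (d + 1), a l ((k - d : ℕ) : SAdic S) * (if i = k + l then 1 else 0) +
      ∑ l ∈ range d, b l ((k - (d + l + 1) : ℕ) : SAdic S) *
        (if i + (l + 1) = k then 1 else 0) := by
  rw [bandPart, add_apply, _root_.sum_apply,
    _root_.sum_apply, lp.coeFn_add, Pi.add_apply, lp_sum_apply, lp_sum_apply]
  congr 1
  · refine sum_congr rfl fun l _ => ?_
    rw [monomial_shift_basisVec _ _ (by omega), lp.coeFn_smul, Pi.smul_apply, basisVec_apply,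
      smul_eq_mul, show k - d + (d + l) = k + l by omega]
  · refine sum_congr rfl fun l hl => ?_
    have := mem_range.1 hl
    rw [monomial_shift_basisVec _ _ (by omega), lp.coeFn_smul, Pi.smul_apply, basisVec_apply,
      smul_eq_mul]
    congr 2
    exact propext ⟨fun h => by omega, fun h => by omega⟩

variable {d : ℕ} (c : ℕ → ℕ → ℂ) (a b : ℕ → C(SAdic S, ℂ))

theorem canonical_shift_entry {k : ℕ} (i : ℕ) (hk : 2 * d ≤ k) :
    (matrixPart shift d c + bandPart shift (diagHom S) d a b) (basisVec k) i =
      bandPart shift (diagHom S) d a b (basisVec k) i := by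
  rw [add_apply, matrixPart_shift_basisVec_of_le c hk, zero_add]

theorem norm_lowerBand_le {k : ℕ} (hk : k < d + 1) :
    ‖a k‖ ≤ ‖matrixPart shift d c + bandPart shift (diagHom S) d a b‖ := by
  refine norm_le_of_forall_natCast _ d fun n => ?_
  -- This entry lies on the `k`-th lower diagonal, beyond the matrix part, and equals `a k` at `n +
  -- d`.
  have h := norm_entry_le (matrixPart shift d c + bandPart shift (diagHom S) d a b)
    (n + 2 * d + k) (n + 2 * d)
  rw [canonical_shift_entry c a b _ (by omega), bandPart_shift_entry a b (by omega),
    sum_eq_single k, sum_eq_zero] at h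
  · simpa [show n + 2 * d - d = n + d by omega] using h
  · intro l _
    rw [if_neg (by omega), mul_zero]
  · intro l _ hl
    rw [if_neg (by omega), mul_zero]
  · intro h'; exact absurd (mem_range.2 hk) h'

theorem norm_upperBand_le {k : ℕ} (hk : k < d) :
    ‖b k‖ ≤ ‖matrixPart shift d c + bandPart shift (diagHom S) d a b‖ := by
  -- In column `n + 2 * d` the function `b k` is evaluated at `n + 2 * d - (d + k + 1)`, whence the
  -- offset.
  refine norm_le_of_forall_natCast _ (d - k - 1) fun n => ?_
  have h := norm_entry_le (matrixPart shift d c + bandPart shift (diagHom S) d a b)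
    (n + 2 * d - (k + 1)) (n + 2 * d)
  rw [canonical_shift_entry c a b _ (by omega), bandPart_shift_entry a b (by omega),
    sum_eq_zero, sum_eq_single k, if_pos (by omega)] at h
  · simpa only [zero_add, mul_one, show n + 2 * d - (d + k + 1) = n + (d - k - 1) by omega] using h
  · intro l _ hl
    rw [if_neg (by omega), mul_zero]
  · intro h'; exact absurd (mem_range.2 hk) h'
  · intro l _
    rw [if_neg (by omega), mul_zero]

/-! ### Norm estimates for canonical forms -/

section Norm

variable {B : Type*} [CStarAlgebra B] {u : B} {ι : C(SAdic S, ℂ) →⋆ₐ[ℂ] B}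

theorem norm_one_le : ‖(1 : B)‖ ≤ 1 := by
  nontriviality B
  exact CStarRing.norm_one.le

theorem SatisfiesRelations.norm_le_one (h : SatisfiesRelations S u ι) : ‖u‖ ≤ 1 := by
  have h1 : ‖u‖ * ‖u‖ ≤ 1 := by
    rw [← CStarRing.norm_star_mul_self, h.isometry]; exact norm_one_le
  nlinarith [norm_nonneg u]

theorem norm_pow_le_one {x : B} (hx : ‖x‖ ≤ 1) (n : ℕ) : ‖x ^ n‖ ≤ 1 := by
  induction n with
  | zero => simpa using norm_one_le (B := B)
  | succ n ih => exact pow_succ x n ▸ (norm_mul_le _ _).trans (mul_le_one₀ ih (norm_nonneg _) hx)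

theorem SatisfiesRelations.norm_monomial_le (h : SatisfiesRelations S u ι) (x : B) (m n : ℕ) :
    ‖u ^ m * x * star u ^ n‖ ≤ ‖x‖ := by
  have h1 := norm_pow_le_one h.norm_le_one m
  have h2 := norm_pow_le_one (x := star u) (by rw [norm_star]; exact h.norm_le_one) n
  calc _ ≤ ‖u ^ m‖ * ‖x‖ * ‖star u ^ n‖ :=
        (norm_mul_le _ _).trans (by gcongr; exact norm_mul_le _ _)
    _ ≤ 1 * ‖x‖ * 1 := by gcongr
    _ = ‖x‖ := by ring

theorem SatisfiesRelations.norm_rangeProj_le (h : SatisfiesRelations S u ι) :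
    ‖star u * u - u * star u‖ ≤ 2 := by
  have h1 : ‖u * star u‖ ≤ 1 := (norm_mul_le _ _).trans
    (mul_le_one₀ h.norm_le_one (norm_nonneg _) (by rw [norm_star]; exact h.norm_le_one))
  have h2 : ‖star u * u‖ ≤ 1 := by rw [h.isometry]; exact norm_one_le
  linarith [norm_sub_le (star u * u) (u * star u)]

theorem SatisfiesRelations.norm_matrixPart_le (h : SatisfiesRelations S u ι) {r : ℝ}
    (hc : ∀ i < 2 * d, ∀ j < 2 * d, ‖c i j‖ ≤ r) :
    ‖matrixPart u d c‖ ≤ (2 * d) * ((2 * d) * (r * 2)) := by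
  have key : ∀ i ∈ range (2 * d), ‖∑ j ∈ range (2 * d),
      c i j • (u ^ i * (star u * u - u * star u) * star u ^ j)‖ ≤ (2 * d) * (r * 2) := by
    intro i hi
    refine (norm_sum_le_of_le _ fun j hj => (?_ : _ ≤ r * 2)).trans_eq
      (by rw [sum_const, card_range, nsmul_eq_mul, Nat.cast_mul, Nat.cast_ofNat])
    have h0 := hc i (mem_range.1 hi) j (mem_range.1 hj)
    rw [norm_smul]
    exact mul_le_mul h0 ((h.norm_monomial_le _ _ _).trans h.norm_rangeProj_le) (norm_nonneg _)
      ((norm_nonneg _).trans h0)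
  refine (norm_sum_le_of_le _ key).trans_eq ?_
  rw [sum_const, card_range, nsmul_eq_mul, Nat.cast_mul, Nat.cast_ofNat]

theorem SatisfiesRelations.norm_bandPart_le (h : SatisfiesRelations S u ι) {r : ℝ}
    (ha : ∀ k < d + 1, ‖a k‖ ≤ r) (hb : ∀ k < d, ‖b k‖ ≤ r) :
    ‖bandPart u ι d a b‖ ≤ (2 * d + 1) * r := by
  have hι : ∀ f, ‖ι f‖ ≤ ‖f‖ := fun f => NonUnitalStarAlgHom.norm_apply_le ι f
  have h1 : ‖∑ k ∈ range (d + 1), u ^ (d + k) * ι (a k) * star u ^ d‖ ≤ (d + 1) * r := by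
    refine (norm_sum_le_of_le _ fun k hk => (h.norm_monomial_le _ _ _).trans
      ((hι _).trans (ha k (mem_range.1 hk)))).trans_eq ?_
    rw [sum_const, card_range, nsmul_eq_mul, Nat.cast_add_one]
  have h2 : ‖∑ k ∈ range d, u ^ d * ι (b k) * star u ^ (d + k + 1)‖ ≤ d * r := by
    refine (norm_sum_le_of_le _ fun k hk => (h.norm_monomial_le _ _ _).trans
      ((hι _).trans (hb k (mem_range.1 hk)))).trans_eq ?_
    rw [sum_const, card_range, nsmul_eq_mul]
  calc _ ≤ (d + 1) * r + d * r := norm_add_le_of_le h1 h2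
    _ = _ := by ring

/-- The matrix part is `T` minus its band part, and the latter has norm at most `(2 * d + 1) * ‖T‖`.
-/
theorem norm_coeff_le {i j : ℕ} (hi : i < 2 * d) (hj : j < 2 * d) :
    ‖c i j‖ ≤ (2 * d + 2) * ‖matrixPart shift d c + bandPart shift (diagHom S) d a b‖ := by
  set T := matrixPart shift d c + bandPart shift (diagHom S) d a b with hT
  have h1 : ‖bandPart shift (diagHom S) d a b‖ ≤ (2 * d + 1) * ‖T‖ :=
    (satisfiesRelations_shift S).norm_bandPart_le a b (fun k hk => norm_lowerBand_le c a b hk)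
      (fun k hk => norm_upperBand_le c a b hk)
  have h2 : matrixPart shift d c = T - bandPart shift (diagHom S) d a b := by
    rw [hT, add_sub_cancel_right]
  rw [← matrixPart_shift_entry c hi hj]
  refine (norm_entry_le _ i j).trans ?_
  rw [h2]
  linarith [norm_sub_le T (bandPart shift (diagHom S) d a b)]

/-- The coefficients are controlled by the concrete operator, and the same coefficients bound the
element of `B`. Crude bounds such as `‖p₀‖ ≤ 2` suffice: only polynomial growth in `d` matters. -/
theorem SatisfiesRelations.norm_canonical_le (h : SatisfiesRelations S u ι) :
    ‖matrixPart u d c + bandPart u ι d a b‖ ≤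
      16 * ((d : ℝ) + 1) ^ 3 *
        ‖matrixPart shift d c + bandPart shift (diagHom S) d a b‖ := by
  set r := ‖matrixPart shift d c + bandPart shift (diagHom S) d a b‖ with hr
  have h1 := h.norm_matrixPart_le (d := d) c fun i hi j hj => norm_coeff_le c a b hi hj
  have h2 := h.norm_bandPart_le (d := d) a b (fun k hk => norm_lowerBand_le c a b hk)
    (fun k hk => norm_upperBand_le c a b hk)
  refine (norm_add_le_of_le h1 h2).trans ?_
  rw [← hr]
  have hr0 : 0 ≤ r := norm_nonneg _
  have hd0 : (0 : ℝ) ≤ d := Nat.cast_nonneg d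
  have : 2 * (d : ℝ) * (2 * d * ((2 * d + 2) * r * 2)) + (2 * d + 1) * r =
      (16 * (d : ℝ) ^ 3 + 16 * d ^ 2 + 2 * d + 1) * r := by ring
  rw [this]
  gcongr
  nlinarith [sq_nonneg (d : ℝ)]

end Norm

end BunceDeddensToeplitz

namespace BunceDeddensToeplitz
open Filter Topology

variable {S : Supernatural}

/-! ### The norm inequality -/

/-- If `t < s`, dividing by `s ^ N n` gives `1 ≤ K * (N n) ^ 3 * (t / s) ^ N n`, whose right side
tends to zero. -/
theorem le_of_forall_pow_le {s t K : ℝ} (ht : 0 ≤ t) {N : ℕ → ℕ}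
    (hN : ∀ n, n ≤ N n) (h : ∀ n, s ^ N n ≤ K * (N n : ℝ) ^ 3 * t ^ N n) : s ≤ t := by
  by_contra! hlt
  have hs0 : 0 < s := ht.trans_lt hlt
  have h1 : Tendsto (fun n : ℕ => (n : ℝ) ^ 3 * (t / s) ^ n) atTop (𝓝 0) :=
    tendsto_pow_const_mul_const_pow_of_lt_one 3 (by positivity) ((div_lt_one hs0).2 hlt)
  have h2 := ((h1.comp (tendsto_atTop_mono hN tendsto_id)).const_mul K)
  rw [mul_zero] at h2
  refine absurd (ge_of_tendsto' h2 (b := 1) fun n => ?_) (by norm_num)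
  have h3 := h n
  simp only [Function.comp_apply]
  rw [div_pow, ← mul_assoc, ← mul_div_assoc, le_div_iff₀ (by positivity), one_mul]
  exact h3

variable {B : Type*} [CStarAlgebra B] {u : B} {ι : C(SAdic S, ℂ) →⋆ₐ[ℂ] B}

theorem SatisfiesRelations.prod {B' : Type*} [CStarAlgebra B'] {u' : B'}
    {ι' : C(SAdic S, ℂ) →⋆ₐ[ℂ] B'} (h : SatisfiesRelations S u ι)
    (h' : SatisfiesRelations S u' ι') : SatisfiesRelations S (u, u') (ι.prod ι') where
  isometry := Prod.ext h.isometry h'.isometry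
  comm f := Prod.ext (h.comm f) (h'.comm f)
  proj f := Prod.ext (h.proj f) (h'.proj f)

theorem map_matrixPart {B' : Type*} [CStarAlgebra B'] (π : B →⋆ₐ[ℂ] B') (d : ℕ) (c : ℕ → ℕ → ℂ) :
    π (matrixPart u d c) = matrixPart (π u) d c := by
  simp [matrixPart, map_sum, map_star]

theorem map_bandPart {B' : Type*} [CStarAlgebra B'] (π : B →⋆ₐ[ℂ] B') (d : ℕ)
    (a b : ℕ → C(SAdic S, ℂ)) :
    π (bandPart u ι d a b) = bandPart (π u) (π.comp ι) d a b := by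
  simp [bandPart, map_sum, map_star]

/-- The pair formed by the concrete generators and a representation of the relations. -/
abbrev jointHom (ι : C(SAdic S, ℂ) →⋆ₐ[ℂ] B) : C(SAdic S, ℂ) →⋆ₐ[ℂ] (HPlus →L[ℂ] HPlus) × B :=
  (diagHom S).prod ι

/-- The canonical form is taken in the product algebra, so that both components of `x` carry the
same coefficients. -/
theorem SatisfiesRelations.norm_snd_le_of_mem_monomialSpan (h : SatisfiesRelations S u ι) {d : ℕ}
    {x : (HPlus →L[ℂ] HPlus) × B} (hx : x ∈ monomialSpan (shift, u) (jointHom ι) d) :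
    ‖x.2‖ ≤ 16 * ((d : ℝ) + 1) ^ 3 * ‖x.1‖ := by
  obtain ⟨c, a, b, rfl⟩ :=
    ((satisfiesRelations_shift S).prod h).monomialSpan_le_canonicalSubmodule d hx
  have h1 := map_matrixPart (u := (shift, u)) (StarAlgHom.fst ℂ (HPlus →L[ℂ] HPlus) B) d c
  have h2 := map_matrixPart (u := (shift, u)) (StarAlgHom.snd ℂ (HPlus →L[ℂ] HPlus) B) d c
  have h3 := map_bandPart (u := (shift, u)) (ι := jointHom ι)
    (StarAlgHom.fst ℂ (HPlus →L[ℂ] HPlus) B) d a b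
  have h4 := map_bandPart (u := (shift, u)) (ι := jointHom ι)
    (StarAlgHom.snd ℂ (HPlus →L[ℂ] HPlus) B) d a b
  rw [jointHom, StarAlgHom.fst_prod] at h3
  rw [jointHom, StarAlgHom.snd_prod] at h4
  simp only [StarAlgHom.fst_apply, StarAlgHom.snd_apply] at h1 h2 h3 h4
  rw [Prod.fst_add, Prod.snd_add, h1, h2, h3, h4]
  exact h.norm_canonical_le c a b

theorem SatisfiesRelations.norm_snd_le_of_mem_adjoin (h : SatisfiesRelations S u ι)
    {x : (HPlus →L[ℂ] HPlus) × B}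
    (hx : x ∈ StarAlgebra.adjoin ℂ ({(shift, u)} ∪ Set.range (jointHom ι))) :
    ‖x.2‖ ≤ ‖x.1‖ := by
  have hj := (satisfiesRelations_shift S).prod h
  obtain ⟨d, hd⟩ := hj.exists_mem_monomialSpan hx
  have hsq : ‖x.2‖ ^ 2 ≤ ‖x.1‖ ^ 2 := by
    -- The element `(x* x) ^ (2 ^ n)` has degree at most `2 ^ n * (d + d)`, and `2 ^ n * (d + d) + 1
    -- ≤ (2 * d + 1) * 2 ^ n`. Self-adjointness of `x* x` turns norms of powers into powers of
    -- norms.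
    refine le_of_forall_pow_le (K := 16 * (2 * (d : ℝ) + 1) ^ 3) (N := fun n => 2 ^ n)
      (by positivity) (fun n => Nat.lt_two_pow_self.le) fun n => ?_
    have h1 := h.norm_snd_le_of_mem_monomialSpan
      (hj.pow_mem_monomialSpan (hj.mul_mem_monomialSpan (star_mem_monomialSpan hd) hd) (2 ^ n))
    rw [Prod.pow_snd, Prod.pow_fst, Prod.snd_mul, Prod.fst_mul, Prod.snd_star, Prod.fst_star,
      (IsSelfAdjoint.star_mul_self x.2).norm_pow_two_pow,
      (IsSelfAdjoint.star_mul_self x.1).norm_pow_two_pow, CStarRing.norm_star_mul_self,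
      CStarRing.norm_star_mul_self, ← pow_two, ← pow_two] at h1
    refine h1.trans (mul_le_mul_of_nonneg_right ?_ (by positivity))
    rw [mul_assoc, ← mul_pow]
    have h2 : (1 : ℝ) ≤ 2 ^ n := one_le_pow₀ (by norm_num)
    gcongr
    push_cast
    nlinarith
  exact (sq_le_sq₀ (norm_nonneg _) (norm_nonneg _)).1 hsq

/-- The graph of the canonical homomorphism from `A_S`. -/
def jointAlgebra (u : B) (ι : C(SAdic S, ℂ) →⋆ₐ[ℂ] B) :
    StarSubalgebra ℂ ((HPlus →L[ℂ] HPlus) × B) :=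
  (StarAlgebra.adjoin ℂ ({(shift, u)} ∪ Set.range (jointHom ι))).topologicalClosure

theorem SatisfiesRelations.norm_snd_le (h : SatisfiesRelations S u ι)
    {x : (HPlus →L[ℂ] HPlus) × B} (hx : x ∈ jointAlgebra u ι) : ‖x.2‖ ≤ ‖x.1‖ := by
  refine closure_minimal (t := {x : (HPlus →L[ℂ] HPlus) × B | ‖x.2‖ ≤ ‖x.1‖})
    (fun y hy => h.norm_snd_le_of_mem_adjoin hy) ?_ hx
  exact isClosed_le (by fun_prop) (by fun_prop)

/-- The product norm is a maximum, so the norm inequality makes the first projection isometric on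
the complete joint algebra. Its range is then closed and contains the generators of `A_S`. -/
theorem SatisfiesRelations.exists_mem_jointAlgebra (h : SatisfiesRelations S u ι)
    {T : HPlus →L[ℂ] HPlus} (hT : T ∈ toeplitzAlgebra S) : ∃ b, (T, b) ∈ jointAlgebra u ι := by
  have hiso : Isometry fun x : jointAlgebra u ι => (x : (HPlus →L[ℂ] HPlus) × B).1 := by
    refine AddMonoidHomClass.isometry_of_norm
      ((StarAlgHom.fst ℂ (HPlus →L[ℂ] HPlus) B).comp (jointAlgebra u ι).subtype) fun x => ?_
    exact (max_eq_left (h.norm_snd_le x.2)).symm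
  have : CompleteSpace (jointAlgebra u ι) :=
    (StarSubalgebra.isClosed_topologicalClosure _).completeSpace_coe
  have hcl : IsClosed (Set.range fun x : jointAlgebra u ι =>
      (x : (HPlus →L[ℂ] HPlus) × B).1) := hiso.isClosedEmbedding.isClosed_range
  have hle : StarAlgebra.adjoin ℂ ({shift} ∪ Set.range (diagHom S)) ≤
      (jointAlgebra u ι).map (StarAlgHom.fst ℂ (HPlus →L[ℂ] HPlus) B) := by
    refine StarAlgebra.adjoin_le ?_
    have hsub : ∀ y ∈ ({(shift, u)} ∪ Set.range (jointHom ι) : Set _), y ∈ jointAlgebra u ι :=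
      fun y hy => StarSubalgebra.le_topologicalClosure _ (StarAlgebra.subset_adjoin ℂ _ hy)
    rintro _ (rfl | ⟨f, rfl⟩)
    · exact ⟨(shift, u), hsub _ (Or.inl rfl), rfl⟩
    · exact ⟨jointHom ι f, hsub _ (Or.inr ⟨f, rfl⟩), rfl⟩
  obtain ⟨⟨⟨T', b⟩, hx⟩, rfl⟩ : T ∈ Set.range fun x : jointAlgebra u ι =>
      (x : (HPlus →L[ℂ] HPlus) × B).1 := by
    refine closure_minimal (fun y hy => ?_) hcl hT
    obtain ⟨x, hx, rfl⟩ := hle hy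
    exact ⟨⟨x, hx⟩, rfl⟩
  exact ⟨b, hx⟩

theorem SatisfiesRelations.snd_eq (h : SatisfiesRelations S u ι) {T : HPlus →L[ℂ] HPlus}
    {b b' : B} (hb : (T, b) ∈ jointAlgebra u ι) (hb' : (T, b') ∈ jointAlgebra u ι) : b = b' := by
  have h1 := h.norm_snd_le (sub_mem hb hb')
  rw [Prod.mk_sub_mk, sub_self, norm_zero] at h1
  exact sub_eq_zero.1 (norm_le_zero_iff.1 h1)

/-- The image of an element of `A_S` under the homomorphism induced by a representation of the
relations. -/
def SatisfiesRelations.liftFun (h : SatisfiesRelations S u ι) (T : toeplitzAlgebra S) : B :=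
  (h.exists_mem_jointAlgebra T.2).choose

theorem SatisfiesRelations.liftFun_mem (h : SatisfiesRelations S u ι) (T : toeplitzAlgebra S) :
    ((T : HPlus →L[ℂ] HPlus), h.liftFun T) ∈ jointAlgebra u ι :=
  (h.exists_mem_jointAlgebra T.2).choose_spec

theorem SatisfiesRelations.liftFun_eq (h : SatisfiesRelations S u ι) {T : toeplitzAlgebra S}
    {x : (HPlus →L[ℂ] HPlus) × B} (hx : x ∈ jointAlgebra u ι) (hT : x.1 = T) :
    h.liftFun T = x.2 :=
  h.snd_eq (h.liftFun_mem T) (hT ▸ hx)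

/-- The homomorphism from `A_S` induced by a representation of the relations. -/
def SatisfiesRelations.lift (h : SatisfiesRelations S u ι) : toeplitzAlgebra S →⋆ₐ[ℂ] B where
  toFun := h.liftFun
  map_one' := h.liftFun_eq (one_mem _) rfl
  map_zero' := h.liftFun_eq (zero_mem _) rfl
  map_mul' T T' := h.liftFun_eq (mul_mem (h.liftFun_mem T) (h.liftFun_mem T')) rfl
  map_add' T T' := h.liftFun_eq (add_mem (h.liftFun_mem T) (h.liftFun_mem T')) rfl
  commutes' c := h.liftFun_eq (algebraMap_mem _ c) rfl
  map_star' T := h.liftFun_eq (star_mem (h.liftFun_mem T)) rfl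

theorem SatisfiesRelations.lift_shiftElem (h : SatisfiesRelations S u ι) :
    h.lift (shiftElem S) = u :=
  h.liftFun_eq (x := (shift, u)) (StarSubalgebra.le_topologicalClosure _
    (StarAlgebra.subset_adjoin ℂ _ (Or.inl rfl))) rfl

theorem SatisfiesRelations.lift_diagElem (h : SatisfiesRelations S u ι) (f : C(SAdic S, ℂ)) :
    h.lift (diagElem S f) = ι f :=
  h.liftFun_eq (x := jointHom ι f) (StarSubalgebra.le_topologicalClosure _
    (StarAlgebra.subset_adjoin ℂ _ (Or.inr ⟨f, rfl⟩))) rfl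

/-! ### Universality -/

theorem starAlgHom_ext_of_generates {A : Type*} [CStarAlgebra A] {s : Set A}
    (hs : (StarAlgebra.adjoin ℂ s).topologicalClosure = ⊤) {φ ψ : A →⋆ₐ[ℂ] B}
    (h : Set.EqOn φ ψ s) : φ = ψ := by
  have hcl : IsClosed {x | φ x = ψ x} :=
    isClosed_eq
    (AddMonoidHomClass.continuous_of_bound φ 1 fun x => by
      simpa using NonUnitalStarAlgHom.norm_apply_le φ x)
    (AddMonoidHomClass.continuous_of_bound ψ 1 fun x => by
      simpa using NonUnitalStarAlgHom.norm_apply_le ψ x)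
  have hle : StarAlgebra.adjoin ℂ s ≤ StarAlgHom.equalizer φ ψ := StarAlgebra.adjoin_le h
  ext x
  have hx : x ∈ (StarAlgebra.adjoin ℂ s).topologicalClosure := hs ▸ StarSubalgebra.mem_top
  exact closure_minimal (fun y hy => hle hy) hcl hx

theorem toeplitzAlgebra_generates (S : Supernatural) :
    (StarAlgebra.adjoin ℂ
      ({shiftElem S} ∪ Set.range (diagElem S))).topologicalClosure = ⊤ := by
  refine eq_top_iff.2 fun T _ => ?_
  have hle : StarAlgebra.adjoin ℂ ({shift} ∪ Set.range (diagHom S)) ≤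
      (StarAlgebra.adjoin ℂ ({shiftElem S} ∪ Set.range (diagElem S))).map
        (toeplitzAlgebra S).subtype := by
    refine StarAlgebra.adjoin_le ?_
    rintro _ (rfl | ⟨f, rfl⟩)
    · exact ⟨shiftElem S, StarAlgebra.subset_adjoin ℂ _ (Or.inl rfl), rfl⟩
    · exact ⟨diagElem S f, StarAlgebra.subset_adjoin ℂ _ (Or.inr ⟨f, rfl⟩), rfl⟩
  change T ∈ closure _
  rw [closure_subtype]
  exact closure_mono (fun y hy => hle hy) T.2

theorem satisfiesRelations_shiftElem (S : Supernatural) :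
    SatisfiesRelations S (shiftElem S) (diagElem S) where
  isometry := Subtype.ext (satisfiesRelations_shift S).isometry
  comm f := Subtype.ext ((satisfiesRelations_shift S).comm f)
  proj f := Subtype.ext ((satisfiesRelations_shift S).proj f)

theorem eqOn_generators {A C : Type*} [CStarAlgebra A] {u : A}
    {ι : C(SAdic S, ℂ) →⋆ₐ[ℂ] A} {φ ψ : A → C} (hu : φ u = ψ u) (hι : ∀ f, φ (ι f) = ψ (ι f)) :
    Set.EqOn φ ψ ({u} ∪ Set.range ι) := by
  rintro _ (rfl | ⟨f, rfl⟩)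
  exacts [hu, hι f]

theorem isUniversal_toeplitzAlgebra (S : Supernatural) :
    IsUniversal.{0, w} S (toeplitzAlgebra S) (shiftElem S) (diagElem S) where
  relations := satisfiesRelations_shiftElem S
  generates := toeplitzAlgebra_generates S
  existsUnique_lift B _ v κ h := by
    refine ⟨h.lift, ⟨h.lift_shiftElem, h.lift_diagElem⟩, fun π hπ => ?_⟩
    refine starAlgHom_ext_of_generates (toeplitzAlgebra_generates S) (eqOn_generators ?_ ?_)
    · rw [hπ.1, h.lift_shiftElem]
    · intro f; rw [hπ.2, h.lift_diagElem]

/-! ### Universe lifts of C*-algebras -/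

instance (A : Type*) [CStarAlgebra A] : StarRing (ULift.{w} A) where
  star x := ⟨star x.down⟩
  star_involutive x := ULift.ext _ _ (star_star x.down)
  star_mul x y := ULift.ext _ _ (star_mul x.down y.down)
  star_add x y := ULift.ext _ _ (star_add x.down y.down)

instance uliftCStarAlgebra (A : Type*) [CStarAlgebra A] : CStarAlgebra (ULift.{w} A) where
  norm_mul_self_le x := CStarRing.norm_mul_self_le x.down
  star_smul c x := ULift.ext _ _ (star_smul c x.down)

/-- The canonical `*`-isomorphism of a C*-algebra with its lift to a larger universe. -/
def uliftStarAlgEquiv (A : Type*) [CStarAlgebra A] : A ≃⋆ₐ[ℂ] ULift.{w} A :=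
  StarAlgEquiv.ofAlgEquiv ULift.algEquiv.symm fun _ => rfl

theorem SatisfiesRelations.map {B' : Type*} [CStarAlgebra B'] (h : SatisfiesRelations S u ι)
    (π : B →⋆ₐ[ℂ] B') : SatisfiesRelations S (π u) (π.comp ι) where
  isometry := by rw [← map_star, ← map_mul, h.isometry, map_one]
  comm f := by
    rw [StarAlgHom.comp_apply, StarAlgHom.comp_apply, ← map_mul, h.comm, map_mul]
  proj f := by
    rw [StarAlgHom.comp_apply, ← map_star, ← map_mul, ← map_mul, ← map_sub, ← map_mul, h.proj,
      map_smul]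

/-- The universal property tests only algebras in universe `w`, so `D` is replaced by its lift and
the resulting map is carried back. -/
theorem IsUniversal.exists_lift {A : Type v} [CStarAlgebra A] {u : A}
    {ι : C(SAdic S, ℂ) →⋆ₐ[ℂ] A} (h : IsUniversal.{v, w} S A u ι) {D : Type} [CStarAlgebra D]
    {x : D} {κ : C(SAdic S, ℂ) →⋆ₐ[ℂ] D} (hx : SatisfiesRelations S x κ) :
    ∃ π : A →⋆ₐ[ℂ] D, π u = x ∧ ∀ f, π (ι f) = κ f := by
  let e := uliftStarAlgEquiv.{w} D
  obtain ⟨π, ⟨h1, h2⟩, -⟩ := h.existsUnique_lift _ _ _ (hx.map (e : D →⋆ₐ[ℂ] ULift.{w} D))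
  refine ⟨(e.symm : ULift.{w} D →⋆ₐ[ℂ] D).comp π, ?_, fun f => ?_⟩
  · rw [StarAlgHom.comp_apply, h1]; exact e.symm_apply_apply _
  · rw [StarAlgHom.comp_apply, h2]; exact e.symm_apply_apply _

/-- The maps induced in the two directions compose to homomorphisms that fix generators, hence to
identities. -/
theorem IsUniversal.existsUnique_starAlgEquiv {A : Type v} [CStarAlgebra A] {u : A}
    {ι : C(SAdic S, ℂ) →⋆ₐ[ℂ] A} (h : IsUniversal.{v, w} S A u ι) :
    ∃! Φ : A ≃⋆ₐ[ℂ] toeplitzAlgebra S, Φ u = shiftElem S ∧ ∀ f, Φ (ι f) = diagElem S f := by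
  obtain ⟨π, h1, h2⟩ := h.exists_lift (satisfiesRelations_shiftElem S)
  have hr := h.relations
  have hleft : (hr.lift.comp π) = StarAlgHom.id ℂ A :=
    starAlgHom_ext_of_generates h.generates (eqOn_generators
      (by simp [h1, hr.lift_shiftElem]) (by simp [h2, hr.lift_diagElem]))
  have hright : (π.comp hr.lift) = StarAlgHom.id ℂ (toeplitzAlgebra S) :=
    starAlgHom_ext_of_generates (toeplitzAlgebra_generates S) (eqOn_generators
      (by simp [h1, hr.lift_shiftElem]) (by simp [h2, hr.lift_diagElem]))
  refine ⟨StarAlgEquiv.ofStarAlgHom π hr.lift hleft hright, ⟨h1, h2⟩, fun Ψ hΨ => ?_⟩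
  have hΨπ : (Ψ : A →⋆ₐ[ℂ] toeplitzAlgebra S) = π :=
    starAlgHom_ext_of_generates h.generates (eqOn_generators
      (hΨ.1.trans h1.symm) fun f => (hΨ.2 f).trans (h2 f).symm)
  ext x : 1
  exact DFunLike.congr_fun hΨπ x

end BunceDeddensToeplitz

end

theorem mainTheorem7 (S : BunceDeddensToeplitz.Supernatural) (hS : S.IsInfinite) :
    BunceDeddensToeplitz.IsUniversal.{0, w} S (BunceDeddensToeplitz.toeplitzAlgebra S)
        (BunceDeddensToeplitz.shiftElem S) (BunceDeddensToeplitz.diagElem S) ∧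
      ∀ (A : Type v) [CStarAlgebra A] (u : A)
        (ι : C(BunceDeddensToeplitz.SAdic S, ℂ) →⋆ₐ[ℂ] A),
        BunceDeddensToeplitz.IsUniversal.{v, w} S A u ι →
          ∃! Φ : A ≃⋆ₐ[ℂ] BunceDeddensToeplitz.toeplitzAlgebra S,
            Φ u = BunceDeddensToeplitz.shiftElem S ∧
              ∀ f, Φ (ι f) = BunceDeddensToeplitz.diagElem S f :=
  ⟨BunceDeddensToeplitz.isUniversal_toeplitzAlgebra S, fun _ _ _ _ h =>
    h.existsUnique_starAlgEquiv⟩
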